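/- For a convex body $K\subset\mathbb R^2$ (a compact convex set with nonempty interior) and $z\in\operatorname{int}K$ let $K^z=(K-z)^*+z$, where $L^*=\{y\in\mathbb R^2:\langle x,y\rangle\le 1\text{ for all }x\in L\}$. Let $s(K)$ be the Santaló point of $K$, that is, the point of $\operatorname{int}K$ at which $z\mapsto\operatorname{vol}(K^z)$ attains its minimum over $\operatorname{int}K$, and let $\mathcal P(K)=\operatorname{vol}(K)\operatorname{vol}(K^{s(K)})$ be the volume product of $K$. Then for every convex body $K\subset\mathbb R^2$ and every nondegenerate triangle $\Delta_2\subset\mathbb R^2$, $$\mathcal P(K)\ \ge\ \mathcal P(\Delta_2)=\frac{27}{4}.$$ -/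

import Mathlib

open MeasureTheory

/-- The polar set `K^* = {y | ⟨x, y⟩ ≤ 1 for all x ∈ K}` of a subset of `ℝⁿ`. -/
def polarBody {n : ℕ} (K : Set (EuclideanSpace ℝ (Fin n))) : Set (EuclideanSpace ℝ (Fin n)) :=
  {y | ∀ x ∈ K, inner ℝ x y ≤ 1}

/-- The polar set `K^z = (K - z)^* + z` of `K` with respect to the point `z`. -/
def polarBodyAt {n : ℕ} (K : Set (EuclideanSpace ℝ (Fin n))) (z : EuclideanSpace ℝ (Fin n)) :
    Set (EuclideanSpace ℝ (Fin n)) :=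
  (fun y => y + z) '' polarBody ((fun x => x - z) '' K)

/-- `s` is a Santaló point of `K`: it lies in the interior of `K`, and there it minimizes the
volume of the polar set `K^z`. -/
def IsSantaloPoint {n : ℕ} (K : Set (EuclideanSpace ℝ (Fin n)))
    (s : EuclideanSpace ℝ (Fin n)) : Prop :=
  s ∈ interior K ∧ ∀ z ∈ interior K, volume (polarBodyAt K s) ≤ volume (polarBodyAt K z)

open Classical in
/-- The Santaló point `s(K)`. For a convex body it exists, see `exists_isSantaloPoint`. -/
noncomputable def santaloPoint {n : ℕ} (K : Set (EuclideanSpace ℝ (Fin n))) :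
    EuclideanSpace ℝ (Fin n) :=
  if h : ∃ s, IsSantaloPoint K s then h.choose else 0

/-- The volume product `P(K) = vol(K) vol(K^{s(K)})`. -/
noncomputable def volumeProduct {n : ℕ} (K : Set (EuclideanSpace ℝ (Fin n))) : ENNReal :=
  volume K * volume (polarBodyAt K (santaloPoint K))

theorem volume_polarBodyAt {n : ℕ} (K : Set (EuclideanSpace ℝ (Fin n)))
    (z : EuclideanSpace ℝ (Fin n)) :
    volume (polarBodyAt K z) = volume {y | ∀ x ∈ K, inner ℝ (x - z) y ≤ 1} := by
  unfold polarBodyAt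
  rw [Set.image_add_right, measure_preimage_add_right]
  simp [polarBody]

theorem volume_polarBodyAt_lt_top {n : ℕ} {K : Set (EuclideanSpace ℝ (Fin n))}
    {z : EuclideanSpace ℝ (Fin n)} (hz : z ∈ interior K) : volume (polarBodyAt K z) < ⊤ := by
  rw [volume_polarBodyAt]
  obtain ⟨ρ, hρ, hb⟩ := Metric.isOpen_iff.1 isOpen_interior z hz
  refine lt_of_le_of_lt (measure_mono ?_)
    (measure_closedBall_lt_top (x := (0 : EuclideanSpace ℝ (Fin n))) (r := 2 / ρ))
  intro y hy
  rw [mem_closedBall_zero_iff]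
  by_cases h0 : y = 0
  · subst h0; simp; positivity
  have hpos : 0 < ‖y‖ := norm_pos_iff.2 h0
  have hx : z + (ρ / 2 / ‖y‖) • y ∈ K := by
    apply interior_subset
    apply hb
    rw [Metric.mem_ball, dist_self_add_left, norm_smul, Real.norm_of_nonneg (by positivity)]
    field_simp
    linarith
  have := hy _ hx
  rw [add_sub_cancel_left, real_inner_smul_left, real_inner_self_eq_norm_sq] at this
  rw [le_div_iff₀ hρ]
  field_simp at this
  linarith

theorem volume_polarBodyAt_eq_top {n : ℕ} {K : Set (EuclideanSpace ℝ (Fin n))}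
    (hc : Convex ℝ K) (hK : IsCompact K) (hne : (interior K).Nonempty)
    {z : EuclideanSpace ℝ (Fin n)} (hz : z ∉ interior K) : volume (polarBodyAt K z) = ⊤ := by
  rw [volume_polarBodyAt]
  obtain ⟨f, hf⟩ := geometric_hahn_banach_open_point hc.interior isOpen_interior hz
  set u := (InnerProductSpace.toDual ℝ (EuclideanSpace ℝ (Fin n))).symm f with hu
  have huf : ∀ x, inner ℝ x u = f x := by
    intro x
    rw [real_inner_comm, hu, InnerProductSpace.toDual_symm_apply]
  have hle : ∀ x ∈ K, f x ≤ f z := by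
    intro x hx
    have h1 : x ∈ closure (interior K) := by
      rw [hc.closure_interior_eq_closure_of_nonempty_interior hne]
      exact subset_closure hx
    exact closure_minimal (fun a ha => (hf a ha).le)
      (isClosed_le f.continuous continuous_const) h1
  have hu0 : 0 < ‖u‖ := by
    rw [norm_pos_iff]
    intro h
    obtain ⟨a, ha⟩ := hne
    have h1 := hf a ha
    rw [← huf, ← huf, h] at h1
    simp at h1
  obtain ⟨R, hR⟩ := (hK.image (continuous_sub_right z)).isBounded.exists_norm_le
  set ε : ℝ := 1 / (|R| + 1) with hε
  have hε0 : 0 < ε := by positivity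
  have hsub : (⋃ k : ℕ, Metric.ball ((k * (2 * ε / ‖u‖)) • u) ε) ⊆
      {y | ∀ x ∈ K, inner ℝ (x - z) y ≤ 1} := by
    intro y hy x hx
    obtain ⟨k, hk⟩ := Set.mem_iUnion.1 hy
    rw [mem_ball_iff_norm] at hk
    set v := y - (k * (2 * ε / ‖u‖)) • u with hv
    have hyv : y = v + (k * (2 * ε / ‖u‖)) • u := by simp [hv]
    rw [hyv, inner_add_right, real_inner_smul_right, huf, map_sub]
    have h1 : inner ℝ (x - z) v ≤ ‖x - z‖ * ‖v‖ := real_inner_le_norm _ _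
    have h2 : ‖x - z‖ ≤ |R| := (hR _ ⟨x, hx, rfl⟩).trans (le_abs_self R)
    have h3 : ‖x - z‖ * ‖v‖ ≤ |R| * ε := by gcongr
    have h4 : |R| * ε ≤ 1 := by
      rw [hε, mul_one_div, div_le_one (by positivity)]; linarith
    have h5 : (k * (2 * ε / ‖u‖)) * (f x - f z) ≤ 0 :=
      mul_nonpos_of_nonneg_of_nonpos (by positivity) (by linarith [hle x hx])
    linarith
  refine top_le_iff.1 (le_trans ?_ (measure_mono hsub))
  rw [measure_iUnion]
  · simp only [Measure.addHaar_ball_center]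
    rw [ENNReal.tsum_const_eq_top_of_ne_zero]
    exact (Metric.measure_ball_pos volume _ hε0).ne'
  · intro i j hij
    apply Metric.ball_disjoint_ball
    rw [dist_eq_norm, ← sub_smul, norm_smul, ← sub_mul, norm_mul,
      Real.norm_of_nonneg (show 0 ≤ 2 * ε / ‖u‖ by positivity), mul_assoc,
      div_mul_cancel₀ _ hu0.ne']
    have h1 : (1 : ℝ) ≤ ‖(i : ℝ) - j‖ := by
      rw [Real.norm_eq_abs]
      have : (1 : ℤ) ≤ |(i : ℤ) - j| := Int.one_le_abs (by omega)
      exact_mod_cast this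
    nlinarith
  · intro i; exact Metric.isOpen_ball.measurableSet

open scoped Pointwise in
theorem lowerSemicontinuous_volume_polarBodyAt {n : ℕ} (K : Set (EuclideanSpace ℝ (Fin n))) :
    LowerSemicontinuous fun z => volume (polarBodyAt K z) := by
  intro z c hc
  simp only [volume_polarBodyAt] at hc ⊢
  set A := {y | ∀ x ∈ K, inner ℝ (x - z) y ≤ 1} with hA
  have hU : A = ⋃ k : ℕ, A ∩ Metric.closedBall 0 k := by
    rw [← Set.inter_iUnion, Metric.iUnion_closedBall_nat, Set.inter_univ]
  have hmono : Monotone fun k : ℕ => A ∩ Metric.closedBall 0 (k : ℝ) := by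
    intro i j hij
    exact Set.inter_subset_inter_right _ (Metric.closedBall_subset_closedBall (by exact_mod_cast hij))
  have hT := tendsto_measure_iUnion_atTop (μ := volume) hmono
  rw [← hU] at hT
  obtain ⟨k, hk⟩ := (hT.eventually_const_lt hc).exists
  simp only [Function.comp] at hk
  set V := volume (A ∩ Metric.closedBall 0 (k : ℝ)) with hV
  have hVt : V ≠ ⊤ :=
    ((measure_mono Set.inter_subset_right).trans_lt measure_closedBall_lt_top).ne
  have hcont : Filter.Tendsto (fun r : ℝ => ENNReal.ofReal (r ^ n) * V) (nhdsWithin 1 (Set.Iio 1))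
      (nhds V) := by
    have h1 : Filter.Tendsto (fun r : ℝ => ENNReal.ofReal (r ^ n)) (nhdsWithin 1 (Set.Iio 1))
        (nhds (ENNReal.ofReal (1 ^ n))) :=
      (ENNReal.continuous_ofReal.comp (continuous_pow n)).continuousWithinAt
    have h2 := ENNReal.Tendsto.mul_const (b := V) h1 (Or.inr hVt)
    simpa using h2
  obtain ⟨r, hr, hr1, hr0⟩ := ((hcont.eventually_const_lt hk).and
    ((eventually_mem_nhdsWithin).and
      (mem_nhdsWithin_of_mem_nhds (lt_mem_nhds (zero_lt_one' ℝ))))).exists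
  have hr1' : r < 1 := hr1
  have hr0' : 0 < r := hr0
  have hball : Metric.ball z ((1 - r) / (k + 1)) ∈ nhds z :=
    Metric.ball_mem_nhds _ (div_pos (by linarith) (by positivity))
  filter_upwards [hball] with w hw
  refine hr.trans_le ?_
  have hs : volume (r • (A ∩ Metric.closedBall 0 (k : ℝ))) = ENNReal.ofReal (r ^ n) * V := by
    rw [Measure.addHaar_smul, finrank_euclideanSpace_fin, abs_of_nonneg (by positivity)]
  rw [← hs]
  apply measure_mono
  rintro _ ⟨y, ⟨hy, hyk⟩, rfl⟩ x hx
  simp only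
  rw [mem_closedBall_zero_iff] at hyk
  rw [Metric.mem_ball, dist_comm, dist_eq_norm, lt_div_iff₀ (by positivity)] at hw
  have e : x - w = (x - z) + (z - w) := by abel
  rw [real_inner_smul_right, e, inner_add_left]
  have h1 := hy x hx
  have h2 : inner ℝ (z - w) y ≤ ‖z - w‖ * ‖y‖ := real_inner_le_norm _ _
  have h3 : ‖z - w‖ * ‖y‖ ≤ ‖z - w‖ * (k + 1) := by gcongr; linarith
  nlinarith

/-- Every convex body in `ℝⁿ` has a Santaló point. -/
theorem exists_isSantaloPoint {n : ℕ} {K : Set (EuclideanSpace ℝ (Fin n))}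
    (hc : Convex ℝ K) (hK : IsCompact K) (hne : (interior K).Nonempty) :
    ∃ s, IsSantaloPoint K s := by
  obtain ⟨s, hsK, hs⟩ := LowerSemicontinuousOn.exists_isMinOn (hne.mono interior_subset) hK
    ((lowerSemicontinuous_volume_polarBodyAt K).lowerSemicontinuousOn K)
  refine ⟨s, ?_, fun z hz => hs (interior_subset hz)⟩
  by_contra h
  obtain ⟨z, hz⟩ := hne
  have h1 : volume (polarBodyAt K s) ≤ volume (polarBodyAt K z) := hs (interior_subset hz)
  rw [volume_polarBodyAt_eq_top hc hK ⟨z, hz⟩ h] at h1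
  exact absurd (h1.trans_lt (volume_polarBodyAt_lt_top hz)) (lt_irrefl _)

/-- The volume product can be computed at any Santaló point of `K`. -/
theorem volumeProduct_eq {n : ℕ} {K : Set (EuclideanSpace ℝ (Fin n))}
    {s : EuclideanSpace ℝ (Fin n)} (hs : IsSantaloPoint K s) :
    volumeProduct K = volume K * volume (polarBodyAt K s) := by
  have h : ∃ s, IsSantaloPoint K s := ⟨s, hs⟩
  have hd : santaloPoint K = h.choose := by simp only [santaloPoint, dif_pos h]
  have h1 : IsSantaloPoint K (santaloPoint K) := by rw [hd]; exact h.choose_spec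
  rw [volumeProduct, le_antisymm (h1.2 _ hs.1) (hs.2 _ h1.1)]

/-! The lower bound holds with any interior point in place of the Santaló point: after a translation
it reads vol(K) vol(K*) ≥ 27/4 for 0 in the interior of K. Minimality at the Santaló point only
serves the upper bound for a triangle, whose centroid already gives 27/4.

For a polygon around 0, twice the area is the sum of `det2` over the edges. Its polar has one vertex
per edge, and twice the polar area is the sum of `polarMass` over the vertices. It remains to show
that the product of these two sums is at least 27, by induction on the number of vertices. Let c, x,
y be consecutive, s = `det2 c x`, t = `det2 x y`, e = `det2 c y`. Sliding x parallel to cy keeps s +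
t and the area, and the polar sum changes only through the term −(s + t − e)²/(e s t). So if e > 0,
moving x away from the balanced position s = t does not increase the polar area, and when x reaches
the line of the next edge a vertex disappears (`exists_canReplace_of_le`). If no such e is positive,
Cauchy–Schwarz gives 2n² ≥ 32 for n ≥ 4 vertices; for three vertices AM–GM gives 27.

A general K is approximated by inscribed polygons. Their area is at most vol(K), but their polars
contain K*, so the polar is first scaled by 1 − η to fit into K* (`inner_smul_dualVertex_le_gauge`);
then η → 0. -/

/-! ### Determinants and orientation -/

/-- The Euclidean plane. -/
abbrev Plane := EuclideanSpace ℝ (Fin 2)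

/-- The determinant of two vectors of the plane. -/
def det2 (a b : Plane) : ℝ := a 0 * b 1 - a 1 * b 0

/-- Twice the signed area of the triangle `abc`. -/
def turn (a b c : Plane) : ℝ := det2 a b + det2 b c - det2 a c

/-- The contribution of the vertex `b`, with neighbours `a` and `c`, to twice the area of the polar
of a polygon. -/
noncomputable def polarMass (a b c : Plane) : ℝ := turn a b c / (det2 a b * det2 b c)

/-- The reflection that exchanges the coordinates. -/
def swapCoord (a : Plane) : Plane := !₂[a 1, a 0]

lemma swapCoord_swapCoord (a : Plane) : swapCoord (swapCoord a) = a := by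
  ext i; fin_cases i <;> simp [swapCoord]

lemma det2_swapCoord (a b : Plane) : det2 (swapCoord a) (swapCoord b) = det2 b a := by
  simp [det2, swapCoord]; ring

lemma turn_swapCoord (a b c : Plane) :
    turn (swapCoord a) (swapCoord b) (swapCoord c) = turn c b a := by
  simp only [turn, det2_swapCoord]; ring

lemma polarMass_swapCoord (a b c : Plane) :
    polarMass (swapCoord a) (swapCoord b) (swapCoord c) = polarMass c b a := by
  simp only [polarMass, turn_swapCoord, det2_swapCoord, mul_comm]

/-! ### Removing a vertex at constant area -/

/-- Used to eliminate the diagonals `det2 b x`, `det2 x z` and `det2 b z`, by dividing by `det2 c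
y`. -/
lemma det2_plucker (a b c d : Plane) :
    det2 a b * det2 c d - det2 a c * det2 b d + det2 a d * det2 b c = 0 := by
  simp only [det2]; ring

/-- The conditions under which the vertex `p` may replace the two consecutive vertices `c`, `x` of
a convex polygon `… a b c x y z …` so that its area is kept and that of its polar does not grow. -/
structure CanReplace (a b c x y z p : Plane) : Prop where
  det_left : 0 < det2 b p
  det_right : 0 < det2 p y
  turn_left : 0 ≤ turn a b p
  turn_mid : 0 ≤ turn b p y
  turn_right : 0 ≤ turn p y z
  area : det2 b p + det2 p y = det2 b c + det2 c x + det2 x y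
  mass : polarMass a b p + polarMass b p y + polarMass p y z ≤
    polarMass a b c + polarMass b c x + polarMass c x y + polarMass x y z

/-- A reflection reverses orientation, so reversing the list of vertices restores it. This exchanges
the roles of c and x. -/
lemma CanReplace.swapCoord {a b c x y z p : Plane}
    (h : CanReplace (swapCoord z) (swapCoord y) (swapCoord x) (swapCoord c) (swapCoord b)
      (swapCoord a) (swapCoord p)) : CanReplace a b c x y z p := by
  obtain ⟨h1, h2, h3, h4, h5, h6, h7⟩ := h
  simp only [det2_swapCoord, turn_swapCoord, polarMass_swapCoord] at *
  exact ⟨h2, h1, h5, h4, h3, by linarith, by linarith⟩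

/-- A vertex x on the segment cy carries no polar mass, so dropping it gives equality. Here α, β, h,
k stand for the determinants of bc, yz, by, cz. -/
lemma mass_le_of_collinear {α β s e h k : ℝ} (hα : 0 < α) (hβ : 0 < β) (hs : 0 < s) {t : ℝ}
    (ht : 0 < t) (he : 0 < e) (heq : s + t = e) :
    (α + e - h) / (α * e) + (e + β - k) / (e * β) ≤
      (α + s - (α * t + h * s) / e) / (α * s) + (s + t - e) / (s * t) +
        (t + β - (s * β + k * t) / e) / (t * β) := by
  subst heq
  apply le_of_eq
  field_simp
  ring

/-- The slide changes (s, t) into (u, s + t − u), and the right side minus the left is (s + t −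
e)²/e · (1/(u(s + t − u)) − 1/(st)). G is `turn b c y`. -/
lemma mass_le_of_slide {α β s t e h k u G : ℝ} (hα : 0 < α) (hβ : 0 < β) (hs : 0 < s)
    (ht : 0 < t) (he : 0 < e) (hh : h = α + e - G) (hlt : e < s + t)
    (hu : u * G = α * (s + t - e)) (hu0 : 0 < u) (hus : u ≤ s) (hst : s ≤ t) :
    G / (α * (s + t - u)) + (s + t - u + β - (u * β + k * (s + t - u)) / e) / ((s + t - u) * β) ≤
      (α + s - (α * t + h * s) / e) / (α * s) + (s + t - e) / (s * t) +
        (t + β - (s * β + k * t) / e) / (t * β) := by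
  have hw : 0 < s + t - u := by linarith
  have key : 1 / (s * t) ≤ 1 / (u * (s + t - u)) := by
    apply one_div_le_one_div_of_le (by positivity)
    nlinarith
  have h1 : G / (α * (s + t - u)) = (s + t - e) / (u * (s + t - u)) := by
    rw [div_eq_div_iff (by positivity) (by positivity)]
    linear_combination (s + t - u) * hu
  have h2 : (s + t - u + β - (u * β + k * (s + t - u)) / e) / ((s + t - u) * β) =
      1 / β + 1 / e - k / (e * β) + (1 - (s + t) / e) / (s + t - u) := by
    field_simp; ring
  have h3 : (t + β - (s * β + k * t) / e) / (t * β) =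
      1 / β + 1 / e - k / (e * β) + (1 - (s + t) / e) / t := by
    field_simp; ring
  have h4 : (α + s - (α * t + h * s) / e) / (α * s) =
      (s + t - e) / (u * e) + (1 - (s + t) / e) / s := by
    have : (s + t - e) / (u * e) = G / (α * e) := by
      rw [div_eq_div_iff (by positivity) (by positivity)]
      linear_combination -e * hu
    rw [this, hh]; field_simp; ring
  rw [h1, h2, h3, h4]
  have h5 : (s + t - e) / (u * e) + (1 - (s + t) / e) / s + (s + t - e) / (s * t) +
      (1 / β + 1 / e - k / (e * β) + (1 - (s + t) / e) / t) -
      ((s + t - e) / (u * (s + t - u)) +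
        (1 / β + 1 / e - k / (e * β) + (1 - (s + t) / e) / (s + t - u))) =
      (s + t - e) ^ 2 / e * (1 / (u * (s + t - u)) - 1 / (s * t)) := by
    field_simp; ring
  have h6 : 0 ≤ (s + t - e) ^ 2 / e * (1 / (u * (s + t - u)) - 1 / (s * t)) :=
    mul_nonneg (by positivity) (by linarith)
  linarith

set_option maxHeartbeats 1000000 in
lemma exists_canReplace_of_le {a b c x y z : Plane} (hab : 0 < det2 a b) (hbc : 0 < det2 b c)
    (hcx : 0 < det2 c x) (hxy : 0 < det2 x y) (hyz : 0 < det2 y z) (hb : 0 ≤ turn a b c)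
    (hc : 0 ≤ turn b c x) (hx : 0 ≤ turn c x y) (hy : 0 ≤ turn x y z) (he : 0 < det2 c y)
    (hle : det2 c x ≤ det2 x y) : ∃ p, CanReplace a b c x y z p := by
  -- The point p is where the line bc, extended past c, meets the parallel to cy through x: μ =
  -- `turn c x y / turn b c y`.
  set μ : ℝ := (det2 c x + det2 x y - det2 c y) / (det2 b c + det2 c y - det2 b y) with hμ
  refine ⟨c + μ • (c - b), ?_⟩
  set p := c + μ • (c - b) with hp
  have e1 : det2 b p = (1 + μ) * det2 b c := by simp [hp, det2]; ring
  have e2 : det2 p y = (1 + μ) * det2 c y - μ * det2 b y := by simp [hp, det2]; ring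
  have e3 : det2 p z = (1 + μ) * det2 c z - μ * det2 b z := by simp [hp, det2]; ring
  have e4 : det2 a p = (1 + μ) * det2 a c - μ * det2 a b := by simp [hp, det2]; ring
  have r1 := det2_plucker b c x y
  have r2 := det2_plucker c x y z
  have r3 := det2_plucker b c y z
  clear_value p
  simp only [turn] at hb hc hx hy
  generalize hα : det2 b c = α at *
  generalize hβ : det2 y z = β at *
  generalize hs : det2 c x = s at *
  generalize ht : det2 x y = t at *
  generalize hcy : det2 c y = e at *
  generalize hh : det2 b y = h at *
  generalize hk : det2 c z = k at *
  generalize hbx : det2 b x = bx at *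
  generalize hxz : det2 x z = xz at *
  generalize hbz : det2 b z = bz at *
  generalize hab' : det2 a b = ab at *
  generalize hac : det2 a c = ac at *
  have hbx' : bx = (α * t + h * s) / e := by rw [eq_div_iff he.ne']; linarith
  have hxz' : xz = (s * β + k * t) / e := by rw [eq_div_iff he.ne']; linarith
  have hbz' : bz = (h * k - α * β) / e := by rw [eq_div_iff he.ne']; linarith
  have hGs : s * (α + e - h) = e * (α + s - bx) + (s + t - e) * α := by
    rw [hbx']; field_simp; ring
  rcases (show e ≤ s + t by linarith).eq_or_lt with heq | hlt
  -- When c, x, y are collinear, p = c and x is dropped. The denominator of μ may vanish, but the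
  -- numerator is 0 in any case.
  · have hμ0 : μ = 0 := by rw [hμ, ← heq]; simp
    rw [hμ0] at e1 e2 e3 e4
    simp only [add_zero, one_mul, zero_mul, sub_zero] at e1 e2 e3 e4
    have hG : 0 ≤ α + e - h := by
      refine nonneg_of_mul_nonneg_right (a := s) ?_ hcx
      rw [hGs, ← heq, sub_self, zero_mul, add_zero]; positivity
    have hR : 0 ≤ e + β - k := by
      refine nonneg_of_mul_nonneg_right (a := t) ?_ hxy
      have : t * (e + β - k) = e * (t + β - xz) := by rw [hxz', heq]; field_simp; ring
      rw [this]; positivity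
    refine ⟨by rw [e1]; exact hbc, by rw [e2]; exact he, ?_, ?_, ?_, ?_, ?_⟩
    · simp only [turn]; rw [e1, e4, hab']; exact hb
    · simp only [turn]; rw [e1, e2, hh]; exact hG
    · simp only [turn]; rw [e2, e3, hβ]; exact hR
    · rw [e1, e2, hα, hs, ht]; linarith
    · have := mass_le_of_collinear (h := h) (k := k) hbc hyz hcx hxy he heq.symm
      simp only [polarMass, turn, e1, e2, e3, e4, hα, hβ, hs, ht, hcy, hh, hbx, hxz, hab',
        hac, hbx', hxz']
      linarith
  · have hG : 0 < α + e - h := by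
      refine pos_of_mul_pos_right (a := s) ?_ hcx.le
      rw [hGs]
      have h1 : 0 < (s + t - e) * α := mul_pos (by linarith) hbc
      have h2 : 0 ≤ e * (α + s - bx) := by positivity
      linarith
    have hμG : μ * (α + e - h) = s + t - e := by rw [hμ]; field_simp
    have hμ0 : 0 < μ := by rw [hμ]; exact div_pos (by linarith) hG
    have hu0 : 0 < μ * α := by positivity
    -- μα is `det2 c p`, the new value of s; convexity at c (`turn b c x ≥ 0`) makes the slide go in
    -- the decreasing direction.
    have hus : μ * α ≤ s := by
      refine le_of_mul_le_mul_right (a := α + e - h) ?_ hG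
      have h1 : μ * α * (α + e - h) = (s + t - e) * α := by linear_combination α * hμG
      have h2 : 0 ≤ e * (α + s - bx) := by positivity
      rw [h1, hGs]; linarith
    have e2' : det2 p y = s + t - μ * α := by rw [e2]; linear_combination hμG
    have e3' : det2 p z = (μ * α * β + k * (s + t - μ * α)) / e := by
      rw [e3, hbz', eq_div_iff he.ne']; field_simp; linear_combination k * hμG
    have hR : 0 < e + β - k := by
      refine pos_of_mul_pos_right (a := t) ?_ hxy.le
      have : t * (e + β - k) = e * (t + β - xz) + β * (s + t - e) := by
        rw [hxz']; field_simp; ring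
      rw [this]
      have : 0 < β * (s + t - e) := mul_pos hyz (by linarith)
      have : 0 ≤ e * (t + β - xz) := by positivity
      linarith
    have hmid : det2 b p + det2 p y - det2 b y = (1 + μ) * (α + e - h) := by
      rw [e1, e2', hh]; linear_combination -hμG
    have hleft : det2 a b + det2 b p - det2 a p = (1 + μ) * (ab + α - ac) := by
      rw [e1, e4, hab']; ring
    refine ⟨by rw [e1]; positivity, by rw [e2']; linarith, ?_, ?_, ?_, ?_, ?_⟩
    · rw [turn, hleft]; positivity
    · rw [turn, hmid]; positivity
    · rw [turn, e2', e3', hβ]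
      have : s + t - μ * α + β - (μ * α * β + k * (s + t - μ * α)) / e =
          (t + β - xz) + (s - μ * α) * (e + β - k) / e := by
        rw [hxz']; field_simp; ring
      rw [this]
      have : 0 ≤ (s - μ * α) * (e + β - k) / e :=
        div_nonneg (mul_nonneg (by linarith) hR.le) he.le
      linarith
    · rw [e1, e2', hα, hs, ht]; ring
    · have := mass_le_of_slide (h := h) (k := k) (u := μ * α) hbc hyz hcx hxy he
        (show h = α + e - (α + e - h) by ring) hlt
        (by linear_combination α * hμG) hu0 hus hle
      have m1 : polarMass a b p = polarMass a b c := by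
        rw [polarMass, turn, hleft, e1, polarMass, turn, hab', hα, hac]
        field_simp
      have m2 : polarMass b p y = (α + e - h) / (α * (s + t - μ * α)) := by
        rw [polarMass, turn, hmid, e1, e2', mul_assoc, mul_div_mul_left _ _ (by positivity)]
      rw [m1, m2]
      simp only [polarMass, turn, e2', e3', hα, hβ, hs, ht, hcy, hbx, hxz, hbx', hxz']
      linarith

/-! ### The inequality for polygons -/

/-- A periodic sequence of points that turns counterclockwise around the origin and to the left. -/
structure IsConvexCycle (n : ℕ) (v : ℕ → Plane) : Prop where
  periodic : ∀ k, v (k + n) = v k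
  det_pos : ∀ k, 0 < det2 (v k) (v (k + 1))
  turn_nonneg : ∀ k, 0 ≤ turn (v k) (v (k + 1)) (v (k + 2))

/-- Twice the area enclosed by a cycle. -/
def cycleArea (n : ℕ) (v : ℕ → Plane) : ℝ := ∑ k ∈ Finset.range n, det2 (v k) (v (k + 1))

/-- Twice the area enclosed by the polar of a cycle. -/
noncomputable def cyclePolarArea (n : ℕ) (v : ℕ → Plane) : ℝ :=
  ∑ k ∈ Finset.range n, polarMass (v k) (v (k + 1)) (v (k + 2))

lemma sum_range_add_of_periodic {n : ℕ} {f : ℕ → ℝ} (hf : ∀ k, f (k + n) = f k) (j : ℕ) :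
    ∑ k ∈ Finset.range n, f (k + j) = ∑ k ∈ Finset.range n, f k := by
  induction j with
  | zero => simp
  | succ j ih =>
    have h := Finset.sum_range_succ' (fun k => f (k + j)) n
    rw [Finset.sum_range_succ, ih] at h
    have h0 : f (n + j) = f (0 + j) := by rw [add_comm, hf, zero_add]
    rw [h0] at h
    have h1 := add_right_cancel h
    rw [h1]
    exact Finset.sum_congr rfl fun k _ => by rw [add_right_comm, add_assoc]

namespace IsConvexCycle

variable {n : ℕ} {v : ℕ → Plane}

lemma shift (h : IsConvexCycle n v) (j : ℕ) : IsConvexCycle n (fun k => v (k + j)) where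
  periodic k := by rw [add_right_comm, h.periodic]
  det_pos k := by rw [add_right_comm]; exact h.det_pos _
  turn_nonneg k := by
    rw [add_right_comm k 1, add_right_comm k 2]; exact h.turn_nonneg _

lemma cycleArea_shift (h : IsConvexCycle n v) (j : ℕ) :
    cycleArea n (fun k => v (k + j)) = cycleArea n v := by
  rw [cycleArea, cycleArea,
    ← sum_range_add_of_periodic (f := fun k => det2 (v k) (v (k + 1))) _ j]
  · exact Finset.sum_congr rfl fun k _ => by rw [add_right_comm]
  · intro k; simp only [add_right_comm k n, h.periodic]

lemma cyclePolarArea_shift (h : IsConvexCycle n v) (j : ℕ) :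
    cyclePolarArea n (fun k => v (k + j)) = cyclePolarArea n v := by
  rw [cyclePolarArea, cyclePolarArea,
    ← sum_range_add_of_periodic (f := fun k => polarMass (v k) (v (k + 1)) (v (k + 2))) _ j]
  · exact Finset.sum_congr rfl fun k _ => by rw [add_right_comm k 1, add_right_comm k 2]
  · intro k; simp only [add_right_comm k n, h.periodic]

lemma exists_of_canReplace {N : ℕ} (h : IsConvexCycle (N + 4) v) {p : Plane}
    (hp : CanReplace (v N) (v (N + 1)) (v (N + 2)) (v (N + 3)) (v (N + 4)) (v (N + 5)) p) :
    ∃ w, IsConvexCycle (N + 3) w ∧ cycleArea (N + 3) w = cycleArea (N + 4) v ∧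
      cyclePolarArea (N + 3) w ≤ cyclePolarArea (N + 4) v := by
  -- Index N + 2 receives p and index N + 3 is dropped. For N = 0 the six vertices around p overlap
  -- cyclically, which `CanReplace` permits.
  let w : ℕ → Plane := fun k => if k % (N + 3) = N + 2 then p else v (k % (N + 3))
  have hper : ∀ k, w (k + (N + 3)) = w k := fun k => by simp [w]
  have hmod : ∀ k i, w (k + i) = w (k % (N + 3) + i) := fun k i => by simp [w]
  have hv0 : v (N + 4) = v 0 := by simpa using h.periodic 0
  have hv1 : v (N + 5) = v 1 := by simpa [add_comm, add_left_comm] using h.periodic 1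
  have w1 : ∀ j, j < N + 2 → w j = v j := fun j hj => by
    simp only [w]; rw [Nat.mod_eq_of_lt (by omega), if_neg (by omega)]
  have w2 : w (N + 2) = p := by simp only [w]; rw [Nat.mod_eq_of_lt (by omega), if_pos rfl]
  have w3 : w (N + 3) = v (N + 4) := by
    have := hper 0
    rw [zero_add] at this
    rw [this, hv0, w1 0 (by omega)]
  have w4 : w (N + 4) = v (N + 5) := by
    have := hper 1
    rw [show 1 + (N + 3) = N + 4 by omega] at this
    rw [this, hv1, w1 1 (by omega)]
  clear_value w
  refine ⟨w, ⟨hper, fun k => ?_, fun k => ?_⟩, ?_, ?_⟩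
  · rw [hmod k 1, ← add_zero k, hmod k 0, add_zero, add_zero]
    have hj : k % (N + 3) < N + 3 := Nat.mod_lt _ (by omega)
    generalize k % (N + 3) = j at hj
    rcases (show j < N + 1 ∨ j = N + 1 ∨ j = N + 2 by omega) with hj | rfl | rfl
    · rw [w1 j (by omega), w1 (j + 1) (by omega)]; exact h.det_pos j
    · rw [w1 _ (by omega), w2]; exact hp.det_left
    · rw [w2, w3]; exact hp.det_right
  · rw [hmod k 1, hmod k 2, ← add_zero k, hmod k 0, add_zero, add_zero]
    have hj : k % (N + 3) < N + 3 := Nat.mod_lt _ (by omega)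
    generalize k % (N + 3) = j at hj
    rcases (show j < N ∨ j = N ∨ j = N + 1 ∨ j = N + 2 by omega) with hj | rfl | rfl | rfl
    · rw [w1 j (by omega), w1 (j + 1) (by omega), w1 (j + 2) (by omega)]; exact h.turn_nonneg j
    · rw [w1 _ (by omega), w1 _ (by omega), w2]; exact hp.turn_left
    · rw [w1 _ (by omega), w2, w3]; exact hp.turn_mid
    · rw [w2, w3, w4]; exact hp.turn_right
  · have hs : ∑ k ∈ Finset.range (N + 1), det2 (w k) (w (k + 1)) =
        ∑ k ∈ Finset.range (N + 1), det2 (v k) (v (k + 1)) :=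
      Finset.sum_congr rfl fun k hk => by
        have := Finset.mem_range.1 hk
        rw [w1 k (by omega), w1 (k + 1) (by omega)]
    rw [cycleArea, cycleArea, Finset.sum_range_succ, Finset.sum_range_succ,
      Finset.sum_range_succ _ (N + 3), Finset.sum_range_succ _ (N + 2),
      Finset.sum_range_succ _ (N + 1), hs, w1 (N + 1) (by omega), w2, w3]
    linarith [hp.area]
  · have hs : ∑ k ∈ Finset.range N, polarMass (w k) (w (k + 1)) (w (k + 2)) =
        ∑ k ∈ Finset.range N, polarMass (v k) (v (k + 1)) (v (k + 2)) :=
      Finset.sum_congr rfl fun k hk => by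
        have := Finset.mem_range.1 hk
        rw [w1 k (by omega), w1 (k + 1) (by omega), w1 (k + 2) (by omega)]
    rw [cyclePolarArea, cyclePolarArea, Finset.sum_range_succ, Finset.sum_range_succ,
      Finset.sum_range_succ, Finset.sum_range_succ _ (N + 3), Finset.sum_range_succ _ (N + 2),
      Finset.sum_range_succ _ (N + 1), Finset.sum_range_succ _ N, hs, w1 N (by omega),
      w1 (N + 1) (by omega), w2, w3, w4]
    linarith [hp.mass]

lemma exists_of_det_pos {N : ℕ} (h : IsConvexCycle (N + 4) v) {i : ℕ}
    (hi : 0 < det2 (v i) (v (i + 2))) :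
    ∃ w, IsConvexCycle (N + 3) w ∧ cycleArea (N + 3) w = cycleArea (N + 4) v ∧
      cyclePolarArea (N + 3) w ≤ cyclePolarArea (N + 4) v := by
  have key : ∀ j, (∃ p, CanReplace (v (N + j)) (v (N + 1 + j)) (v (N + 2 + j)) (v (N + 3 + j))
      (v (N + 4 + j)) (v (N + 5 + j)) p) → ∃ w, IsConvexCycle (N + 3) w ∧
      cycleArea (N + 3) w = cycleArea (N + 4) v ∧
      cyclePolarArea (N + 3) w ≤ cyclePolarArea (N + 4) v := by
    rintro j ⟨p, hp⟩
    obtain ⟨w, hw1, hw2, hw3⟩ := (h.shift j).exists_of_canReplace hp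
    exact ⟨w, hw1, hw2.trans (h.cycleArea_shift j), hw3.trans (h.cyclePolarArea_shift j).le⟩
  -- Moving one period ahead makes room for the vertices that precede i.
  rw [← h.periodic i, ← h.periodic (i + 2), show i + (N + 4) = i + N + 4 by omega,
    show i + 2 + (N + 4) = i + N + 6 by omega] at hi
  have hd := h.det_pos
  have ht := h.turn_nonneg
  rcases le_total (det2 (v (i + N + 4)) (v (i + N + 5)))
    (det2 (v (i + N + 5)) (v (i + N + 6))) with hle | hle
  · apply key (i + 2)
    have := exists_canReplace_of_le (hd (i + N + 2)) (hd (i + N + 3)) (hd (i + N + 4))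
      (hd (i + N + 5)) (hd (i + N + 6)) (ht (i + N + 2)) (ht (i + N + 3)) (ht (i + N + 4))
      (ht (i + N + 5)) hi hle
    convert this using 4 <;> omega
  -- The other determinant is the smaller one, so the middle vertex slides the other way: the
  -- previous case after reflection.
  · apply key (i + 3)
    obtain ⟨p, hp⟩ := exists_canReplace_of_le
      (a := swapCoord (v (i + N + 3 + 5))) (b := swapCoord (v (i + N + 3 + 4)))
      (c := swapCoord (v (i + N + 3 + 3))) (x := swapCoord (v (i + N + 3 + 2)))
      (y := swapCoord (v (i + N + 3 + 1))) (z := swapCoord (v (i + N + 3)))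
      (by rw [det2_swapCoord]; exact hd _) (by rw [det2_swapCoord]; exact hd _)
      (by rw [det2_swapCoord]; exact hd _) (by rw [det2_swapCoord]; exact hd _)
      (by rw [det2_swapCoord]; exact hd _) (by rw [turn_swapCoord]; exact ht _)
      (by rw [turn_swapCoord]; exact ht _) (by rw [turn_swapCoord]; exact ht _)
      (by rw [turn_swapCoord]; exact ht _)
      (by rw [det2_swapCoord]; exact hi)
      (by rw [det2_swapCoord, det2_swapCoord]; exact hle)
    rw [← swapCoord_swapCoord p] at hp
    refine ⟨swapCoord p, ?_⟩
    convert hp.swapCoord using 2 <;> omega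

/-- Each turn is at least d k + d (k + 1), so each polar mass is at least the sum of the
reciprocals; Cauchy–Schwarz then bounds the product by 2n² ≥ 32 from below. -/
lemma of_forall_det_nonpos (h : IsConvexCycle n v) (hn : 4 ≤ n)
    (hi : ∀ i, det2 (v i) (v (i + 2)) ≤ 0) : 27 ≤ cycleArea n v * cyclePolarArea n v := by
  have hd := h.det_pos
  set d : ℕ → ℝ := fun k => det2 (v k) (v (k + 1)) with hdef
  have hm : ∀ k, (d k)⁻¹ + (d (k + 1))⁻¹ ≤ polarMass (v k) (v (k + 1)) (v (k + 2)) := by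
    intro k
    have h1 := hd k
    have h2 := hd (k + 1)
    rw [polarMass, turn, le_div_iff₀ (mul_pos h1 h2)]
    have : ((d k)⁻¹ + (d (k + 1))⁻¹) * (d k * d (k + 1)) = d k + d (k + 1) := by
      have := (hd k).ne'; have := (hd (k + 1)).ne'
      simp only [hdef]; field_simp; ring
    simp only [hdef] at this
    rw [show k + 2 = k + 1 + 1 from rfl] at *
    simp only [hdef]
    rw [this]
    have := hi k
    linarith
  have hsum : 2 * ∑ k ∈ Finset.range n, (d k)⁻¹ ≤ cyclePolarArea n v := by
    have h1 := Finset.sum_le_sum fun k (_ : k ∈ Finset.range n) => hm k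
    rw [Finset.sum_add_distrib, sum_range_add_of_periodic (f := fun k => (d k)⁻¹) _ 1] at h1
    · rw [cyclePolarArea]; linarith
    · intro k; simp only [hdef, add_right_comm k n, h.periodic]
  have hcs : (n : ℝ) ^ 2 ≤ (∑ k ∈ Finset.range n, d k) * ∑ k ∈ Finset.range n, (d k)⁻¹ := by
    have := Finset.sum_sq_le_sum_mul_sum_of_sq_le_mul (Finset.range n) (r := fun _ => (1 : ℝ))
      (f := d) (g := fun k => (d k)⁻¹) (fun k _ => (hd k).le) (fun k _ => (inv_pos.2 (hd k)).le)
      (fun k _ => by rw [mul_inv_cancel₀ (hd k).ne', one_pow])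
    simpa using this
  have hS : 0 ≤ ∑ k ∈ Finset.range n, d k := Finset.sum_nonneg fun k _ => (hd k).le
  have hn' : (4 : ℝ) ≤ n := by exact_mod_cast hn
  have h3 := mul_le_mul_of_nonneg_left hsum hS
  change 27 ≤ (∑ k ∈ Finset.range n, d k) * _
  nlinarith

/-- All three turns equal x + y + z, so the product is (x + y + z)³/(xyz), and AM–GM applies. -/
lemma of_three (h : IsConvexCycle 3 v) : 27 ≤ cycleArea 3 v * cyclePolarArea 3 v := by
  have h0 : 0 < det2 (v 0) (v 1) := h.det_pos 0
  have h1 : 0 < det2 (v 1) (v 2) := h.det_pos 1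
  have h2 : 0 < det2 (v 2) (v 0) := by have := h.det_pos 2; rwa [h.periodic 0] at this
  have p0 : v 3 = v 0 := h.periodic 0
  have p1 : v 4 = v 1 := h.periodic 1
  have anti : ∀ a b : Plane, det2 a b = -det2 b a := fun a b => by simp only [det2]; ring
  simp only [cycleArea, cyclePolarArea, Finset.sum_range_succ, Finset.sum_range_zero, polarMass,
    turn, zero_add, Nat.reduceAdd, p0, p1]
  rw [anti (v 0) (v 2), anti (v 1) (v 0), anti (v 2) (v 1)]
  generalize det2 (v 0) (v 1) = x at *
  generalize det2 (v 1) (v 2) = y at *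
  generalize det2 (v 2) (v 0) = z at *
  have : (x + y + z) * ((x + y + z) / (x * y) + (x + y + z) / (y * z) + (x + y + z) / (z * x)) =
      (x + y + z) ^ 3 / (x * y * z) := by field_simp; ring
  have key : 27 ≤ (x + y + z) ^ 3 / (x * y * z) := by
    rw [le_div_iff₀ (by positivity)]
    nlinarith [mul_nonneg h0.le (sq_nonneg (y - z)), mul_nonneg h1.le (sq_nonneg (x - z)),
      mul_nonneg h2.le (sq_nonneg (x - y)), mul_nonneg h0.le (sq_nonneg (x - z)),
      mul_nonneg h0.le (sq_nonneg (x - y)), mul_nonneg h1.le (sq_nonneg (x - y)),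
      mul_nonneg h1.le (sq_nonneg (y - z)), mul_nonneg h2.le (sq_nonneg (x - z)),
      mul_nonneg h2.le (sq_nonneg (y - z))]
  rw [← this] at key
  convert key using 2
  ring

/-- The cycle may wind around the origin more than once; the induction never needs a single turn. -/
theorem le_cycleArea_mul_cyclePolarArea (N : ℕ) : ∀ v, IsConvexCycle (N + 3) v →
    27 ≤ cycleArea (N + 3) v * cyclePolarArea (N + 3) v := by
  induction N with
  | zero => exact fun v h => h.of_three
  | succ N ih =>
    intro v h
    by_cases hi : ∃ i, 0 < det2 (v i) (v (i + 2))
    · obtain ⟨i, hi⟩ := hi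
      obtain ⟨w, hw, hS, hD⟩ := h.exists_of_det_pos hi
      refine (ih w hw).trans ?_
      rw [hS]
      exact mul_le_mul_of_nonneg_left hD (Finset.sum_nonneg fun k _ => (h.det_pos k).le)
    · push Not at hi
      exact h.of_forall_det_nonpos (by omega) hi

end IsConvexCycle

/-! ### Volumes of triangles and of their unions -/

lemma inner_plane (x y : Plane) : inner ℝ x y = x 0 * y 0 + x 1 * y 1 := by
  simp [PiLp.inner_apply, Fin.sum_univ_two, mul_comm]

/-- The standard triangle. -/
def stdTriangle : Set Plane := {y | 0 ≤ y 0 ∧ 0 ≤ y 1 ∧ y 0 + y 1 ≤ 1}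

lemma measurableSet_stdTriangle : MeasurableSet stdTriangle := by
  have h0 : Continuous fun y : Plane => y 0 := by fun_prop
  have h1 : Continuous fun y : Plane => y 1 := by fun_prop
  exact ((isClosed_le continuous_const h0).inter ((isClosed_le continuous_const h1).inter
    (isClosed_le (h0.add h1) continuous_const))).measurableSet

lemma volume_stdTriangle : volume stdTriangle = ENNReal.ofReal (1 / 2) := by
  have e1 := (EuclideanSpace.volume_preserving_symm_measurableEquiv_toLp (Fin 2)).symm
  have e2 := (volume_preserving_finTwoArrow ℝ).symm
  have e3 := e1.comp e2
  rw [← e3.measure_preimage measurableSet_stdTriangle.nullMeasurableSet]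
  have hset : (⇑(MeasurableEquiv.toLp 2 (Fin 2 → ℝ)).symm.symm ∘
      ⇑(MeasurableEquiv.finTwoArrow (α := ℝ)).symm) ⁻¹' stdTriangle =
      {p : ℝ × ℝ | p.1 ∈ Set.Icc 0 1 ∧ p.2 ∈ Set.Icc 0 (1 - p.1)} := by
    ext ⟨x, y⟩
    simp [stdTriangle, MeasurableEquiv.finTwoArrow]
    constructor
    · rintro ⟨h1, h2, h3⟩; refine ⟨⟨h1, ?_⟩, h2, ?_⟩ <;> linarith
    · rintro ⟨⟨h1, h2⟩, h3, h4⟩; refine ⟨h1, h3, ?_⟩; linarith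
  have hms : MeasurableSet {p : ℝ × ℝ | p.1 ∈ Set.Icc 0 1 ∧ p.2 ∈ Set.Icc 0 (1 - p.1)} :=
    measurableSet_region_between_cc measurable_const (measurable_const.sub measurable_id)
      measurableSet_Icc
  have hslice : (fun x : ℝ => volume (Prod.mk x ⁻¹'
      {p : ℝ × ℝ | p.1 ∈ Set.Icc 0 1 ∧ p.2 ∈ Set.Icc 0 (1 - p.1)})) =
      (Set.Icc 0 1).indicator fun x => ENNReal.ofReal (1 - x) := by
    funext x
    by_cases hx : x ∈ Set.Icc (0 : ℝ) 1
    · have : Prod.mk x ⁻¹' {p : ℝ × ℝ | p.1 ∈ Set.Icc 0 1 ∧ p.2 ∈ Set.Icc 0 (1 - p.1)} =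
          Set.Icc 0 (1 - x) := by
        ext y; exact and_iff_right hx
      rw [this, Set.indicator_of_mem hx, Real.volume_Icc, sub_zero]
    · have : Prod.mk x ⁻¹' {p : ℝ × ℝ | p.1 ∈ Set.Icc 0 1 ∧ p.2 ∈ Set.Icc 0 (1 - p.1)} = ∅ := by
        ext y; exact iff_of_false (fun h => hx h.1) id
      rw [this, Set.indicator_of_notMem hx, measure_empty]
  rw [hset, Measure.volume_eq_prod, Measure.prod_apply hms, hslice,
    lintegral_indicator measurableSet_Icc, ← ofReal_integral_eq_lintegral_ofReal]
  · rw [integral_Icc_eq_integral_Ioc, ← intervalIntegral.integral_of_le zero_le_one]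
    congr 1
    rw [intervalIntegral.integral_sub (by simp) (by simp), integral_id]
    norm_num
  · exact (Continuous.continuousOn (by fun_prop)).integrableOn_compact isCompact_Icc
  · filter_upwards [ae_restrict_mem measurableSet_Icc] with x hx
    exact sub_nonneg.2 hx.2

/-- The linear map that sends the standard basis to `u`, `w`. -/
noncomputable def basisMap (u w : Plane) : Plane →ₗ[ℝ] Plane where
  toFun y := y 0 • u + y 1 • w
  map_add' x y := by simp [add_smul]; abel
  map_smul' c y := by simp [mul_smul]

lemma basisMap_apply (u w y : Plane) : basisMap u w y = y 0 • u + y 1 • w := rfl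

lemma det_basisMap (u w : Plane) : LinearMap.det (basisMap u w) = det2 u w := by
  rw [← LinearMap.det_toMatrix (EuclideanSpace.basisFun (Fin 2) ℝ).toBasis, Matrix.det_fin_two]
  simp [LinearMap.toMatrix_apply, basisMap_apply, det2]
  ring

lemma volume_basisMap_image (u w : Plane) :
    volume (basisMap u w '' stdTriangle) = ENNReal.ofReal (|det2 u w| / 2) := by
  rw [Measure.addHaar_image_linearMap, det_basisMap, volume_stdTriangle,
    ← ENNReal.ofReal_mul (abs_nonneg _), mul_one_div]

lemma convexHull_eq_basisMap_image (u w : Plane) :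
    convexHull ℝ {0, u, w} = basisMap u w '' stdTriangle := by
  have hmem : ∀ x y : ℝ, 0 ≤ x → 0 ≤ y → x + y ≤ 1 →
      x • u + y • w ∈ basisMap u w '' stdTriangle := fun x y hx hy hxy =>
    ⟨!₂[x, y], ⟨by simpa, by simpa, by simpa⟩, by simp [basisMap_apply]⟩
  apply subset_antisymm
  · refine convexHull_min ?_ (Convex.linear_image ?_ _)
    · rintro x (rfl | rfl | rfl)
      · simpa using hmem 0 0 le_rfl le_rfl (by norm_num)
      · simpa using hmem 1 0 zero_le_one le_rfl (by norm_num)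
      · simpa using hmem 0 1 le_rfl zero_le_one (by norm_num)
    · rintro x ⟨hx0, hx1, hx2⟩ y ⟨hy0, hy1, hy2⟩ a b ha hb hab
      refine ⟨?_, ?_, ?_⟩ <;> simp only [PiLp.add_apply, PiLp.smul_apply, smul_eq_mul]
      · positivity
      · positivity
      · nlinarith
  · rintro _ ⟨y, ⟨hy0, hy1, hy2⟩, rfl⟩
    rw [basisMap_apply]
    have h := convex_convexHull ℝ {0, u, w}
    have h0 : (0 : Plane) ∈ convexHull ℝ {0, u, w} := subset_convexHull _ _ (by simp)
    have hu : u ∈ convexHull ℝ {0, u, w} := subset_convexHull _ _ (by simp)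
    have hw : w ∈ convexHull ℝ {0, u, w} := subset_convexHull _ _ (by simp)
    have := h.sum_mem (t := Finset.univ) (w := ![1 - y 0 - y 1, y 0, y 1]) (z := ![0, u, w])
      (by intro i _; fin_cases i <;> simp <;> linarith) (by simp [Fin.sum_univ_three]; ring)
      (by intro i _; fin_cases i <;> simpa)
    simpa [Fin.sum_univ_three] using this

lemma volume_inner_eq_zero {f : Plane} (hf : f ≠ 0) : volume {x : Plane | inner ℝ f x = 0} = 0 := by
  have := Measure.addHaar_submodule (volume : Measure Plane)
    (LinearMap.ker (innerSL ℝ f : Plane →L[ℝ] ℝ).toLinearMap) ?_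
  · exact this
  · intro h
    have : f ∈ LinearMap.ker (innerSL ℝ f : Plane →L[ℝ] ℝ).toLinearMap := h ▸ trivial
    apply hf
    simpa using this

/-- The volume of a set that contains triangles `0 u k w k` that are separated by linear
functionals. -/
lemma sum_det2_le_volume {C : Set Plane} {n : ℕ} {u w f : ℕ → Plane}
    (hC : ∀ k < n, basisMap (u k) (w k) '' stdTriangle ⊆ C) (hd : ∀ k < n, 0 ≤ det2 (u k) (w k))
    (hu : ∀ k < n, ∀ j < n, inner ℝ (f j) (u k) ≤ inner ℝ (f k) (u k))
    (hw : ∀ k < n, ∀ j < n, inner ℝ (f j) (w k) ≤ inner ℝ (f k) (w k))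
    (hf : ∀ k < n, ∀ j < n, k ≠ j → f k ≠ f j) :
    ENNReal.ofReal ((∑ k ∈ Finset.range n, det2 (u k) (w k)) / 2) ≤ volume C := by
  have hsep : ∀ k < n, ∀ j < n, ∀ x ∈ basisMap (u k) (w k) '' stdTriangle,
      inner ℝ (f j) x ≤ inner ℝ (f k) x := by
    rintro k hk j hj _ ⟨y, ⟨hy0, hy1, -⟩, rfl⟩
    simp only [basisMap_apply, inner_add_right, real_inner_smul_right]
    have := mul_le_mul_of_nonneg_left (hu k hk j hj) hy0
    have := mul_le_mul_of_nonneg_left (hw k hk j hj) hy1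
    linarith
  have hmeas : ∀ k, NullMeasurableSet (basisMap (u k) (w k) '' stdTriangle) volume := by
    intro k
    rw [← convexHull_eq_basisMap_image]
    exact (Set.Finite.isCompact_convexHull (𝕜 := ℝ) (Set.toFinite _)).measurableSet.nullMeasurableSet
  have hU := measure_biUnion_finset₀ (μ := volume) (s := Finset.range n)
    (f := fun k => basisMap (u k) (w k) '' stdTriangle) ?_ fun k _ => hmeas k
  · rw [Finset.sum_div, ENNReal.ofReal_sum_of_nonneg]
    · calc _ = ∑ k ∈ Finset.range n, volume (basisMap (u k) (w k) '' stdTriangle) := by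
            refine Finset.sum_congr rfl fun k hk => ?_
            rw [volume_basisMap_image, abs_of_nonneg (hd k (Finset.mem_range.1 hk))]
        _ ≤ volume C := by
            rw [← hU]
            exact measure_mono (Set.iUnion₂_subset fun k hk => hC k (Finset.mem_range.1 hk))
    · intro k hk
      have := hd k (Finset.mem_range.1 hk)
      positivity
  · intro k hk j hj hkj
    have hk' : k < n := by simpa using hk
    have hj' : j < n := by simpa using hj
    -- On triangle k the functional f k dominates all the others, so two triangles meet only on the
    -- line where their functionals agree.
    refine measure_mono_null (t := {x | inner ℝ (f k - f j) x = 0}) ?_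
      (volume_inner_eq_zero (sub_ne_zero.2 (hf k hk' j hj' hkj)))
    rintro x ⟨hx1, hx2⟩
    rw [Set.mem_ofPred_eq, inner_sub_left]
    linarith [hsep k hk' j hj' x hx1, hsep j hj' k hk' x hx2]

/-- The map y ↦ ((1 − ⟨a, y⟩)/3, (1 − ⟨b, y⟩)/3) carries this set onto the standard triangle. Its
linear part is M, and it vanishes at the vertex c, where the first two constraints are equalities.
-/
lemma volume_polar_triangle {a b : Plane} (hd : det2 a b ≠ 0) :
    volume {y : Plane | inner ℝ a y ≤ 1 ∧ inner ℝ b y ≤ 1 ∧ inner ℝ (-(a + b)) y ≤ 1} =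
      ENNReal.ofReal (9 / (2 * |det2 a b|)) := by
  set M : Plane →ₗ[ℝ] Plane := basisMap (-(1 / 3 : ℝ) • !₂[a 0, b 0]) (-(1 / 3 : ℝ) • !₂[a 1, b 1])
    with hM
  set c : Plane := !₂[(b 1 - a 1) / det2 a b, (a 0 - b 0) / det2 a b] with hc
  have hMdet : LinearMap.det M = det2 a b / 9 := by
    rw [hM, det_basisMap]; simp [det2]; ring
  have hset : {y : Plane | inner ℝ a y ≤ 1 ∧ inner ℝ b y ≤ 1 ∧ inner ℝ (-(a + b)) y ≤ 1} =
      (fun y => y + -c) ⁻¹' (M ⁻¹' stdTriangle) := by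
    have ha : a 0 * c 0 + a 1 * c 1 = 1 := by
      simp only [hc]; simp; field_simp; simp only [det2]; ring
    have hb : b 0 * c 0 + b 1 * c 1 = 1 := by
      simp only [hc]; simp; field_simp; simp only [det2]; ring
    ext y
    simp only [Set.mem_preimage, stdTriangle, hM, basisMap_apply, Set.mem_ofPred_eq,
      inner_plane]
    clear_value c
    simp
    constructor
    · rintro ⟨h1, h2, h3⟩
      refine ⟨?_, ?_, ?_⟩ <;> linarith
    · rintro ⟨h1, h2, h3⟩
      refine ⟨?_, ?_, ?_⟩ <;> linarith
  rw [hset, measure_preimage_add_right, Measure.addHaar_preimage_linearMap _ (by rw [hMdet]; positivity),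
    hMdet, volume_stdTriangle, ← ENNReal.ofReal_mul (abs_nonneg _)]
  congr 1
  have : 0 < |det2 a b| := abs_pos.2 hd
  rw [abs_inv, abs_div, abs_of_pos (show (0 : ℝ) < 9 by norm_num)]
  field_simp

/-! ### Unit vectors and dual vertices -/

/-- The unit vector in direction `θ`. -/
noncomputable def unitVec (θ : ℝ) : Plane := !₂[Real.cos θ, Real.sin θ]

lemma continuous_unitVec : Continuous unitVec := by
  unfold unitVec; fun_prop

lemma det2_unitVec (s t : ℝ) : det2 (unitVec s) (unitVec t) = Real.sin (t - s) := by
  simp [det2, unitVec, Real.sin_sub]; ring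

lemma inner_unitVec (s t : ℝ) : inner ℝ (unitVec s) (unitVec t) = Real.cos (t - s) := by
  simp [inner_plane, unitVec, Real.cos_sub]; ring

lemma norm_unitVec (t : ℝ) : ‖unitVec t‖ = 1 := by
  rw [← sq_eq_sq₀ (norm_nonneg _) zero_le_one, ← real_inner_self_eq_norm_sq, inner_unitVec]
  simp

lemma unitVec_ne_zero (t : ℝ) : unitVec t ≠ 0 := by
  rw [← norm_ne_zero_iff, norm_unitVec]; exact one_ne_zero

lemma unitVec_injOn {s t : ℝ} (h : unitVec s = unitVec t) (h1 : |t - s| < 2 * Real.pi) :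
    s = t := by
  have h2 := inner_unitVec s t
  rw [h, real_inner_self_eq_norm_sq, norm_unitVec, one_pow] at h2
  obtain ⟨h3, h4⟩ := abs_lt.1 h1
  have := (Real.cos_eq_one_iff_of_lt_of_lt h3 h4).1 h2.symm
  linarith

lemma cos_le_cos_of_abs_mem {φ α : ℝ} (h0 : 0 ≤ α) (h1 : α ≤ |φ|) (h2 : |φ| ≤ 2 * Real.pi - α) :
    Real.cos φ ≤ Real.cos α := by
  rw [← Real.cos_abs φ]
  rcases le_total |φ| Real.pi with h | h
  · exact Real.cos_le_cos_of_nonneg_of_le_pi h0 h h1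
  · rw [← Real.cos_two_pi_sub]
    exact Real.cos_le_cos_of_nonneg_of_le_pi h0 (by linarith) (by linarith)

/-- The point dual to the edge from `a` to `b`. -/
noncomputable def dualVertex (a b : Plane) : Plane :=
  (det2 a b)⁻¹ • !₂[b 1 - a 1, a 0 - b 0]

lemma inner_dualVertex (a b x : Plane) :
    inner ℝ x (dualVertex a b) = (det2 x b + det2 a x) / det2 a b := by
  simp [inner_plane, dualVertex, div_eq_inv_mul, det2]; ring

lemma inner_dualVertex_left {a b : Plane} (h : 0 < det2 a b) :
    inner ℝ a (dualVertex a b) = 1 := by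
  rw [inner_dualVertex, show det2 a a = 0 by simp [det2, mul_comm], add_zero, div_self h.ne']

lemma inner_dualVertex_right {a b : Plane} (h : 0 < det2 a b) :
    inner ℝ b (dualVertex a b) = 1 := by
  rw [inner_dualVertex, show det2 b b = 0 by simp [det2, mul_comm], zero_add, div_self h.ne']

/-- This justifies `polarMass`: the dual vertices of the two edges at b span, with 0, the triangle
of the polar that belongs to b. -/
lemma det2_dualVertex {a b c : Plane} :
    det2 (dualVertex a b) (dualVertex b c) = polarMass a b c := by
  have : det2 (dualVertex a b) (dualVertex b c) =
      (det2 a b)⁻¹ * (det2 b c)⁻¹ * turn a b c := by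
    simp only [dualVertex, turn]
    generalize (det2 a b)⁻¹ = p
    generalize (det2 b c)⁻¹ = q
    simp [det2]; ring
  rw [this, polarMass, div_eq_mul_inv, mul_inv, mul_comm]

lemma det2_smul_smul (s t : ℝ) (a b : Plane) : det2 (s • a) (t • b) = s * t * det2 a b := by
  simp [det2]; ring

lemma smul_eq_add_of_det2 (a b x : Plane) :
    det2 a b • x = det2 x b • a + det2 a x • b := by
  ext i; fin_cases i <;> simp [det2] <;> ring

/-! ### Boundary points and the gauge -/

section Gauge

variable {K : Set Plane}

lemma le_gauge_of_smul_eq {a b x : Plane} (hc : Convex ℝ K) (h0 : K ∈ nhds 0)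
    (ha : gauge K a = 1) {p q : ℝ} (hp : 0 ≤ p) (hq : 0 ≤ q) (h : p • a = x + q • b) :
    p ≤ gauge K x + q * gauge K b := by
  have := gauge_add_le hc (absorbent_nhds_zero h0) x (q • b)
  rwa [← h, gauge_smul_of_nonneg hp, gauge_smul_of_nonneg hq, ha, smul_eq_mul, smul_eq_mul,
    mul_one] at this

/-- Outside the open cone over the edge ab, the line ab has left the interior of K. For s ≤ 0 ≤ t
this is the triangle inequality for the gauge in t b = d x + (−s) a, with d = `det2 a b`. -/
lemma inner_dualVertex_le_gauge {a b x : Plane} (hc : Convex ℝ K) (h0 : K ∈ nhds 0)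
    (ha : gauge K a = 1) (hb : gauge K b = 1) (hd : 0 < det2 a b)
    (hx : det2 x b ≤ 0 ∨ det2 a x ≤ 0) : inner ℝ x (dualVertex a b) ≤ gauge K x := by
  have hdec := smul_eq_add_of_det2 a b x
  set s := det2 x b
  set t := det2 a x
  rw [inner_dualVertex, div_le_iff₀ hd]
  have hg : gauge K (det2 a b • x) = gauge K x * det2 a b := by
    rw [gauge_smul_of_nonneg hd.le, smul_eq_mul, mul_comm]
  have hg0 : 0 ≤ gauge K (det2 a b • x) := gauge_nonneg _
  change s + t ≤ _
  rw [← hg]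
  rcases hx with hs | ht
  · rcases le_total t 0 with ht | ht
    · linarith
    · have := le_gauge_of_smul_eq (x := det2 a b • x) (p := t) (q := -s) hc h0 hb ht
        (by linarith) (b := a) (by rw [hdec, neg_smul]; abel)
      rw [ha] at this
      linarith
  · rcases le_total s 0 with hs | hs
    · linarith
    · have := le_gauge_of_smul_eq (x := det2 a b • x) (p := s) (q := -t) hc h0 ha hs
        (by linarith) (b := b) (by rw [hdec, neg_smul]; abel)
      rw [hb] at this
      linarith

/-- Inside the cone K may bulge beyond the edge, but (s + t) a = d x + t (a − b) bounds s + t by the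
gauge of d x plus t η; the factor 1 − η absorbs this excess. -/
lemma inner_smul_dualVertex_le_gauge {a b : Plane} (hc : Convex ℝ K) (h0 : K ∈ nhds 0)
    (ha : gauge K a = 1) (hb : gauge K b = 1) (hd : 0 < det2 a b) {η : ℝ} (h1 : η ≤ 1)
    (hη : gauge K (a - b) ≤ η) (x : Plane) :
    inner ℝ x ((1 - η) • dualVertex a b) ≤ gauge K x := by
  have hη0 : 0 ≤ η := (gauge_nonneg _).trans hη
  have hg0 : 0 ≤ gauge K x := gauge_nonneg _
  rw [real_inner_smul_right]
  by_cases hx : det2 x b ≤ 0 ∨ det2 a x ≤ 0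
  · have := inner_dualVertex_le_gauge hc h0 ha hb hd hx
    have h2 := mul_le_mul_of_nonneg_left this (sub_nonneg.2 h1)
    have h3 := mul_nonneg hη0 hg0
    linarith
  · push Not at hx
    have hdec := smul_eq_add_of_det2 a b x
    rw [inner_dualVertex]
    obtain ⟨hs, ht⟩ := hx
    set s := det2 x b
    set t := det2 a x
    rw [mul_div_assoc', div_le_iff₀ hd]
    have hg : gauge K (det2 a b • x) = gauge K x * det2 a b := by
      rw [gauge_smul_of_nonneg hd.le, smul_eq_mul, mul_comm]
    rw [← hg]
    have := le_gauge_of_smul_eq (x := det2 a b • x) (p := s + t) (q := t) hc h0 ha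
      (by linarith) ht.le (b := a - b) (by rw [hdec, add_smul, smul_sub]; abel)
    have h2 := mul_le_mul_of_nonneg_left hη ht.le
    have h3 := mul_nonneg hs.le hη0
    linarith

/-- The point of the boundary of `K` in direction `θ`. -/
noncomputable def boundaryPoint (K : Set Plane) (θ : ℝ) : Plane :=
  (gauge K (unitVec θ))⁻¹ • unitVec θ

lemma gauge_unitVec_pos (hb : Bornology.IsBounded K) (h0 : K ∈ nhds 0) (θ : ℝ) :
    0 < gauge K (unitVec θ) :=
  (gauge_pos (absorbent_nhds_zero h0) (NormedSpace.isVonNBounded_of_isBounded ℝ hb)).2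
    (unitVec_ne_zero θ)

lemma gauge_boundaryPoint (hb : Bornology.IsBounded K) (h0 : K ∈ nhds 0) (θ : ℝ) :
    gauge K (boundaryPoint K θ) = 1 := by
  have := gauge_unitVec_pos hb h0 θ
  rw [boundaryPoint, gauge_smul_of_nonneg (by positivity), smul_eq_mul, inv_mul_cancel₀ this.ne']

lemma continuous_boundaryPoint (hc : Convex ℝ K) (hb : Bornology.IsBounded K)
    (h0 : K ∈ nhds 0) : Continuous (boundaryPoint K) :=
  (((continuous_gauge hc h0).comp continuous_unitVec).inv₀
    fun θ => (gauge_unitVec_pos hb h0 θ).ne').smul continuous_unitVec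

lemma boundaryPoint_add_two_pi (θ : ℝ) :
    boundaryPoint K (θ + 2 * Real.pi) = boundaryPoint K θ := by
  simp [boundaryPoint, unitVec]

lemma boundaryPoint_injOn (hb : Bornology.IsBounded K) (h0 : K ∈ nhds 0) {s t : ℝ}
    (h : boundaryPoint K s = boundaryPoint K t) (h1 : |t - s| < 2 * Real.pi) : s = t := by
  apply unitVec_injOn _ h1
  have hs := gauge_unitVec_pos hb h0 s
  have ht := gauge_unitVec_pos hb h0 t
  have hn := congrArg norm h
  simp only [boundaryPoint] at h hn
  rw [norm_smul, norm_smul, norm_unitVec, norm_unitVec, mul_one, mul_one,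
    Real.norm_of_nonneg (by positivity), Real.norm_of_nonneg (by positivity)] at hn
  rw [hn] at h
  exact smul_right_injective _ (inv_pos.2 ht).ne' h

lemma det2_boundaryPoint (s t : ℝ) : det2 (boundaryPoint K s) (boundaryPoint K t) =
    (gauge K (unitVec s))⁻¹ * (gauge K (unitVec t))⁻¹ * Real.sin (t - s) := by
  rw [boundaryPoint, boundaryPoint, det2_smul_smul, det2_unitVec]

lemma exists_forall_gauge_sub_le (hc : Convex ℝ K) (hb : Bornology.IsBounded K)
    (h0 : K ∈ nhds 0) {η : ℝ} (hη : 0 < η) : ∃ n : ℕ, 3 ≤ n ∧ ∀ k < n,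
      gauge K (boundaryPoint K (2 * Real.pi * k / n) -
        boundaryPoint K (2 * Real.pi * (k + 1 : ℕ) / n)) ≤ η := by
  have hu := (isCompact_Icc (a := (0 : ℝ)) (b := 2 * Real.pi)).uniformContinuousOn_of_continuous
    (continuous_boundaryPoint hc hb h0).continuousOn
  have hg := tendsto_gauge_nhds_zero (s := K) h0
  obtain ⟨δ, hδ, hδ'⟩ := Metric.eventually_nhds_iff.1 (hg.eventually (eventually_lt_nhds hη))
  obtain ⟨ε, hε, hε'⟩ := Metric.uniformContinuousOn_iff.1 hu δ hδ
  obtain ⟨m, hm⟩ := exists_nat_gt (2 * Real.pi / ε)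
  -- The summand 3 ensures at least three vertices, so that consecutive angles differ by less than
  -- π.
  refine ⟨m + 3, by omega, fun k hk => ?_⟩
  have hn : (0 : ℝ) < (m + 3 : ℕ) := by positivity
  have hk' : ((k + 1 : ℕ) : ℝ) ≤ (m + 3 : ℕ) := by exact_mod_cast hk
  have hmem : ∀ j : ℕ, (j : ℝ) ≤ (m + 3 : ℕ) →
      2 * Real.pi * j / (m + 3 : ℕ) ∈ Set.Icc 0 (2 * Real.pi) := fun j hj =>
    ⟨by positivity, by rw [div_le_iff₀ hn]; gcongr⟩
  refine (hδ' ?_).le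
  rw [dist_zero_right, ← dist_eq_norm]
  refine hε' _ (hmem k (le_trans (by push_cast; linarith) hk')) _ (hmem _ hk') ?_
  rw [dist_comm, Real.dist_eq, ← sub_div, ← mul_sub]
  push_cast
  rw [add_sub_cancel_left, mul_one, abs_of_nonneg (by positivity), div_lt_comm₀ (by positivity) hε]
  linarith

end Gauge

/-! ### Inscribed polygons -/

/-- No equally spaced direction lies strictly inside the cone between two neighbouring ones. -/
lemma sin_nonpos_or_sin_nonpos {n : ℕ} {j k : ℕ} (hj : j < n) (hk : k < n) :
    Real.sin (2 * Real.pi * (k + 1 : ℕ) / n - 2 * Real.pi * j / n) ≤ 0 ∨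
      Real.sin (2 * Real.pi * j / n - 2 * Real.pi * k / n) ≤ 0 := by
  have hn : (0 : ℝ) < n := by exact_mod_cast (Nat.zero_le j).trans_lt hj
  have hπ := Real.pi_pos
  set c := 2 * Real.pi / n with hcdef
  have hc : 0 < c := by positivity
  have hcn : c * n = 2 * Real.pi := by rw [hcdef]; field_simp
  have hconv : ∀ i : ℕ, 2 * Real.pi * i / n = c * i := fun i => by rw [hcdef]; ring
  rw [hconv, hconv, hconv, ← mul_sub, ← mul_sub]
  have hj' : (j : ℝ) + 1 ≤ n := by exact_mod_cast hj
  have hk' : (k : ℝ) + 1 ≤ n := by exact_mod_cast hk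
  have hj0 : (0 : ℝ) ≤ j := by positivity
  have hk0 : (0 : ℝ) ≤ k := by positivity
  have hneg : ∀ x : ℝ, 0 ≤ x → c * x ≤ Real.pi → Real.sin (c * -x) ≤ 0 := fun x h1 h2 => by
    rw [mul_neg, Real.sin_neg, neg_nonpos]
    exact Real.sin_nonneg_of_nonneg_of_le_pi (by positivity) h2
  have hbig : ∀ x : ℝ, Real.pi ≤ c * x → x ≤ n → Real.sin (c * x) ≤ 0 := fun x h1 h2 => by
    rw [← Real.sin_sub_two_pi]
    have : c * x ≤ c * n := mul_le_mul_of_nonneg_left h2 hc.le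
    exact Real.sin_nonpos_of_nonpos_of_neg_pi_le (by linarith) (by linarith)
  push_cast
  rcases lt_or_ge k j with h | h
  · have h' : (k : ℝ) + 1 ≤ j := by exact_mod_cast h
    rcases le_total (c * (j - k)) Real.pi with h1 | h1
    · left
      rw [show (k : ℝ) + 1 - j = -(j - k - 1) by ring]
      exact hneg _ (by linarith) (by nlinarith)
    · right
      exact hbig _ h1 (by linarith)
  · have h' : (j : ℝ) ≤ k := by exact_mod_cast h
    rcases le_total (c * (k - j)) Real.pi with h1 | h1
    · right
      rw [show (j : ℝ) - k = -(k - j) by ring]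
      exact hneg _ (by linarith) h1
    · left
      exact hbig _ (by nlinarith) (by linarith)

/-- The vertices, at equally spaced angles, of a polygon inscribed in `K`. -/
noncomputable def inscribedCycle (K : Set Plane) (n k : ℕ) : Plane :=
  boundaryPoint K (2 * Real.pi * k / n)

section InscribedCycle

variable {K : Set Plane} {n : ℕ}

lemma inscribedCycle_periodic (hn : 3 ≤ n) (k : ℕ) :
    inscribedCycle K n (k + n) = inscribedCycle K n k := by
  have hn0 : (n : ℝ) ≠ 0 := by positivity
  rw [inscribedCycle, inscribedCycle, ← boundaryPoint_add_two_pi (2 * Real.pi * k / n)]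
  congr 1
  push_cast
  rw [mul_add, add_div, mul_div_assoc _ (n : ℝ), div_self hn0, mul_one]

lemma inscribedCycle_mod (hn : 3 ≤ n) (k i : ℕ) :
    inscribedCycle K n (k % n + i) = inscribedCycle K n (k + i) := by
  conv_rhs => rw [← Nat.mod_add_div k n]
  generalize k / n = m
  induction m with
  | zero => simp
  | succ m ih => rw [Nat.mul_succ, ← add_assoc, add_right_comm, inscribedCycle_periodic hn, ih]

variable (hb : Bornology.IsBounded K) (h0 : K ∈ nhds 0) (hn : 3 ≤ n)
include hb h0 hn

lemma inscribedCycle_det_pos (k : ℕ) :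
    0 < det2 (inscribedCycle K n k) (inscribedCycle K n (k + 1)) := by
  have hn' : (3 : ℝ) ≤ n := by exact_mod_cast hn
  have h1 := gauge_unitVec_pos hb h0 (2 * Real.pi * k / n)
  have h2 := gauge_unitVec_pos hb h0 (2 * Real.pi * (k + 1 : ℕ) / n)
  rw [inscribedCycle, inscribedCycle, det2_boundaryPoint]
  have : 0 < Real.sin (2 * Real.pi * (k + 1 : ℕ) / n - 2 * Real.pi * k / n) := by
    have hπ := Real.pi_pos
    rw [show 2 * Real.pi * (k + 1 : ℕ) / n - 2 * Real.pi * k / n = 2 * Real.pi / n by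
      push_cast; ring]
    apply Real.sin_pos_of_pos_of_lt_pi (by positivity)
    rw [div_lt_iff₀ (by linarith)]
    nlinarith
  positivity

lemma inscribedCycle_cone (j k : ℕ) :
    det2 (inscribedCycle K n j) (inscribedCycle K n (k + 1)) ≤ 0 ∨
      det2 (inscribedCycle K n k) (inscribedCycle K n j) ≤ 0 := by
  rw [← add_zero j, ← add_zero k, ← inscribedCycle_mod hn j, ← inscribedCycle_mod hn k, add_zero,
    add_zero, add_zero, ← inscribedCycle_mod hn k]
  simp only [inscribedCycle, det2_boundaryPoint]
  have hpos := fun t => inv_pos.2 (gauge_unitVec_pos hb h0 t)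
  exact (sin_nonpos_or_sin_nonpos (Nat.mod_lt j (by omega)) (Nat.mod_lt k (by omega))).imp
    (fun h => mul_nonpos_of_nonneg_of_nonpos (mul_pos (hpos _) (hpos _)).le h)
    (fun h => mul_nonpos_of_nonneg_of_nonpos (mul_pos (hpos _) (hpos _)).le h)

lemma inner_inscribedCycle_dualVertex_le_one (hc : Convex ℝ K) (j k : ℕ) :
    inner ℝ (inscribedCycle K n j)
      (dualVertex (inscribedCycle K n k) (inscribedCycle K n (k + 1))) ≤ 1 :=
  (inner_dualVertex_le_gauge hc h0 (gauge_boundaryPoint hb h0 _) (gauge_boundaryPoint hb h0 _)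
    (inscribedCycle_det_pos hb h0 hn k) (inscribedCycle_cone hb h0 hn j k)).trans_eq
    (gauge_boundaryPoint hb h0 _)

lemma isConvexCycle_inscribedCycle (hc : Convex ℝ K) : IsConvexCycle n (inscribedCycle K n) where
  periodic := inscribedCycle_periodic hn
  det_pos := inscribedCycle_det_pos hb h0 hn
  turn_nonneg k := by
    have h := inner_inscribedCycle_dualVertex_le_one hb h0 hn hc (k + 2) k
    rw [inner_dualVertex, div_le_iff₀ (inscribedCycle_det_pos hb h0 hn k)] at h
    have : det2 (inscribedCycle K n (k + 2)) (inscribedCycle K n (k + 1)) =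
      -det2 (inscribedCycle K n (k + 1)) (inscribedCycle K n (k + 2)) := by
      simp only [det2]; ring
    rw [turn]
    linarith

lemma inscribedCycle_area_le (hc : Convex ℝ K) (hcl : IsClosed K) :
    ENNReal.ofReal (cycleArea n (inscribedCycle K n) / 2) ≤ volume K := by
  have hn' : (3 : ℝ) ≤ n := by exact_mod_cast hn
  have hn0 : (0 : ℝ) < n := by linarith
  have hπ := Real.pi_pos
  have hmem : ∀ θ, boundaryPoint K θ ∈ K := fun θ => by
    have := (gauge_le_one_iff_mem_closure hc h0).1 (gauge_boundaryPoint hb h0 θ).le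
    rwa [hcl.closure_eq] at this
  have hcos : ∀ φ p : ℝ, φ = p * (Real.pi / n) → 1 ≤ |p| → |p| ≤ 2 * n - 1 →
      Real.cos φ ≤ Real.cos (Real.pi / n) := by
    rintro _ p rfl h1 h2
    have hα : 0 < Real.pi / n := by positivity
    have e : (2 * n - 1) * (Real.pi / n) = 2 * Real.pi - Real.pi / n := by field_simp
    apply cos_le_cos_of_abs_mem hα.le
    · rw [abs_mul, abs_of_pos hα]; nlinarith
    · rw [abs_mul, abs_of_pos hα, ← e]; gcongr
  -- Vertex directions differ from mid-edge directions by odd multiples of π/n.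
  have hodd : ∀ j k : ℕ, j < n → k < n → ∀ ε : ℤ, |ε| = 1 →
      1 ≤ |2 * ((k : ℝ) - j) + ε| ∧ |2 * ((k : ℝ) - j) + ε| ≤ 2 * n - 1 := by
    intro j k hj hk ε hε
    have h1 : (1 : ℤ) ≤ |2 * ((k : ℤ) - j) + ε| := by
      apply Int.one_le_abs; rcases eq_or_eq_neg_of_abs_eq hε with rfl | rfl <;> omega
    have h2 : |2 * ((k : ℤ) - j) + ε| ≤ 2 * n - 1 := by
      rw [abs_le]; rcases eq_or_eq_neg_of_abs_eq hε with rfl | rfl <;> omega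
    exact ⟨by exact_mod_cast h1, by exact_mod_cast h2⟩
  have hinner : ∀ (k : ℕ) (t : ℝ), inner ℝ (unitVec t) (inscribedCycle K n k) =
      (gauge K (unitVec (2 * Real.pi * k / n)))⁻¹ * Real.cos (2 * Real.pi * k / n - t) := by
    intro k t
    rw [inscribedCycle, boundaryPoint, real_inner_smul_right, inner_unitVec]
  -- The separating functionals point along the bisectors of the sectors.
  refine sum_det2_le_volume (f := fun k => unitVec (2 * Real.pi * k / n + Real.pi / n))
    (u := inscribedCycle K n) (w := fun k => inscribedCycle K n (k + 1)) ?_ ?_ ?_ ?_ ?_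
  · intro k _
    rw [← convexHull_eq_basisMap_image]
    refine convexHull_min ?_ hc
    rintro x (rfl | rfl | rfl)
    · exact mem_of_mem_nhds h0
    · exact hmem _
    · exact hmem _
  · exact fun k _ => (inscribedCycle_det_pos hb h0 hn k).le
  · intro k hk j hj
    simp only [hinner]
    refine mul_le_mul_of_nonneg_left ?_ (inv_pos.2 (gauge_unitVec_pos hb h0 _)).le
    obtain ⟨h1, h2⟩ := hodd j k hj hk (-1) rfl
    rw [show 2 * Real.pi * k / n - (2 * Real.pi * k / n + Real.pi / n) = -(Real.pi / n) by ring,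
      Real.cos_neg]
    exact hcos _ _ (by push_cast; ring) h1 h2
  · intro k hk j hj
    simp only [hinner]
    refine mul_le_mul_of_nonneg_left ?_ (inv_pos.2 (gauge_unitVec_pos hb h0 _)).le
    obtain ⟨h1, h2⟩ := hodd j k hj hk 1 rfl
    rw [show 2 * Real.pi * (k + 1 : ℕ) / n - (2 * Real.pi * k / n + Real.pi / n) = Real.pi / n by
      push_cast; ring]
    exact hcos _ _ (by push_cast; ring) h1 h2
  · intro k hk j hj hkj h
    have h1 := unitVec_injOn h (by
      rw [show 2 * Real.pi * j / n + Real.pi / n - (2 * Real.pi * k / n + Real.pi / n) =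
        2 * Real.pi * (((j : ℝ) - k) / n) by ring, abs_mul, abs_of_pos (by positivity)]
      refine mul_lt_of_lt_one_right (by positivity) ?_
      rw [abs_div, Nat.abs_cast, div_lt_one hn0, abs_lt]
      have : (j : ℝ) < n := by exact_mod_cast hj
      have : (k : ℝ) < n := by exact_mod_cast hk
      have : (0 : ℝ) ≤ j := by positivity
      have : (0 : ℝ) ≤ k := by positivity
      constructor <;> linarith)
    apply hkj
    field_simp at h1
    have : (k : ℝ) = j := by linarith
    exact_mod_cast this

lemma inscribedCycle_polarArea_le (hc : Convex ℝ K) {η : ℝ} (h1 : η < 1)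
    (hη : ∀ k < n, gauge K (inscribedCycle K n k - inscribedCycle K n (k + 1)) ≤ η) :
    ENNReal.ofReal ((1 - η) ^ 2 * cyclePolarArea n (inscribedCycle K n) / 2) ≤
      volume (polarBody K) := by
  have hn' : (3 : ℝ) ≤ n := by exact_mod_cast hn
  have hn0 : (0 : ℝ) < n := by linarith
  have hπ := Real.pi_pos
  have hη' : ∀ k, gauge K (inscribedCycle K n k - inscribedCycle K n (k + 1)) ≤ η := fun k => by
    have := hη (k % n) (Nat.mod_lt _ (by omega))
    rw [← add_zero (k % n), add_zero, inscribedCycle_mod hn, ← add_zero (k % n),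
      inscribedCycle_mod hn, add_zero] at this
    exact this
  have hpol : ∀ k, (1 - η) • dualVertex (inscribedCycle K n k) (inscribedCycle K n (k + 1)) ∈
      polarBody K := fun k x hx =>
    (inner_smul_dualVertex_le_gauge hc h0 (gauge_boundaryPoint hb h0 _)
      (gauge_boundaryPoint hb h0 _) (inscribedCycle_det_pos hb h0 hn k) h1.le (hη' k) x).trans
      (gauge_le_one_of_mem hx)
  have hle : ∀ j k, inner ℝ (inscribedCycle K n j)
      ((1 - η) • dualVertex (inscribedCycle K n k) (inscribedCycle K n (k + 1))) ≤ 1 - η := by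
    intro j k
    rw [real_inner_smul_right]
    exact mul_le_of_le_one_right (by linarith)
      (inner_inscribedCycle_dualVertex_le_one hb h0 hn hc j k)
  have hconv : Convex ℝ (polarBody K) := by
    intro y hy z hz a b ha hb hab x hx
    rw [inner_add_right, real_inner_smul_right, real_inner_smul_right]
    have := mul_le_mul_of_nonneg_left (hy x hx) ha
    have := mul_le_mul_of_nonneg_left (hz x hx) hb
    linarith
  have hdet : ∀ k, det2 ((1 - η) • dualVertex (inscribedCycle K n k) (inscribedCycle K n (k + 1)))
      ((1 - η) • dualVertex (inscribedCycle K n (k + 1)) (inscribedCycle K n (k + 1 + 1))) =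
      (1 - η) ^ 2 * polarMass (inscribedCycle K n k) (inscribedCycle K n (k + 1))
        (inscribedCycle K n (k + 2)) := fun k => by
    rw [det2_smul_smul, det2_dualVertex, sq]
  have key := sum_det2_le_volume (C := polarBody K) (n := n)
    -- The vertex shared by the two edges separates: it pairs to 1 − η, the maximum over all
    -- vertices, with both scaled dual vertices.
    (f := fun k => inscribedCycle K n (k + 1))
    (u := fun k => (1 - η) • dualVertex (inscribedCycle K n k) (inscribedCycle K n (k + 1)))
    (w := fun k => (1 - η) • dualVertex (inscribedCycle K n (k + 1))
      (inscribedCycle K n (k + 1 + 1))) ?_ ?_ ?_ ?_ ?_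
  · simp only [hdet, ← Finset.mul_sum] at key
    exact key
  · intro k _
    rw [← convexHull_eq_basisMap_image]
    refine convexHull_min ?_ hconv
    rintro x (rfl | rfl | rfl)
    · intro x _; simp
    · exact hpol _
    · exact hpol _
  · intro k _
    rw [hdet]
    have h := isConvexCycle_inscribedCycle hb h0 hn hc
    exact mul_nonneg (sq_nonneg _)
      (div_nonneg (h.turn_nonneg k) (mul_pos (h.det_pos k) (h.det_pos (k + 1))).le)
  · intro k _ j _
    refine (hle _ _).trans_eq ?_
    rw [real_inner_smul_right, inner_dualVertex_right (inscribedCycle_det_pos hb h0 hn _), mul_one]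
  · intro k _ j _
    refine (hle _ _).trans_eq ?_
    rw [real_inner_smul_right, inner_dualVertex_left (inscribedCycle_det_pos hb h0 hn _), mul_one]
  · intro k hk j hj hkj h
    have h1 := boundaryPoint_injOn hb h0 h (by
      push_cast
      rw [show 2 * Real.pi * ((j : ℝ) + 1) / n - 2 * Real.pi * ((k : ℝ) + 1) / n =
        2 * Real.pi * (((j : ℝ) - k) / n) by ring, abs_mul, abs_of_pos (by positivity)]
      refine mul_lt_of_lt_one_right (by positivity) ?_
      rw [abs_div, Nat.abs_cast, div_lt_one hn0, abs_lt]
      have : (j : ℝ) < n := by exact_mod_cast hj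
      have : (k : ℝ) < n := by exact_mod_cast hk
      have : (0 : ℝ) ≤ j := by positivity
      have : (0 : ℝ) ≤ k := by positivity
      constructor <;> linarith)
    apply hkj
    field_simp at h1
    push_cast at h1
    have : (k : ℝ) = j := by linarith
    exact_mod_cast this

end InscribedCycle

/-! ### From polygons to convex bodies -/

/-- Mahler's inequality for planar convex bodies that contain the origin in their interior. -/
theorem le_volume_mul_volume_polarBody {K : Set Plane} (hc : Convex ℝ K) (hK : IsCompact K)
    (h0 : K ∈ nhds 0) : 27 / 4 ≤ volume K * volume (polarBody K) := by
  have hb := hK.isBounded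
  have key : ∀ η : ℝ, 0 < η → η < 1 →
      ENNReal.ofReal ((1 - η) ^ 2 * (27 / 4)) ≤ volume K * volume (polarBody K) := by
    intro η hη h1
    obtain ⟨n, hn, hfine⟩ := exists_forall_gauge_sub_le hc hb h0 hη
    have hcyc := isConvexCycle_inscribedCycle hb h0 hn hc
    have hmain : 27 ≤ cycleArea n (inscribedCycle K n) * cyclePolarArea n (inscribedCycle K n) := by
      obtain ⟨N, rfl⟩ := Nat.exists_eq_add_of_le' hn
      exact IsConvexCycle.le_cycleArea_mul_cyclePolarArea N _ hcyc
    have hS : 0 ≤ cycleArea n (inscribedCycle K n) :=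
      Finset.sum_nonneg fun k _ => (hcyc.det_pos k).le
    refine le_trans ?_ (mul_le_mul' (inscribedCycle_area_le hb h0 hn hc hK.isClosed)
      (inscribedCycle_polarArea_le hb h0 hn hc h1 hfine))
    rw [← ENNReal.ofReal_mul (by positivity)]
    apply ENNReal.ofReal_le_ofReal
    have := mul_le_mul_of_nonneg_left hmain (sq_nonneg (1 - η))
    linarith
  have hcont : Filter.Tendsto (fun η : ℝ => ENNReal.ofReal ((1 - η) ^ 2 * (27 / 4)))
      (nhdsWithin 0 (Set.Ioi 0)) (nhds (ENNReal.ofReal ((1 - 0) ^ 2 * (27 / 4)))) :=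
    ((ENNReal.continuous_ofReal.comp (by fun_prop)).tendsto (0 : ℝ)).mono_left nhdsWithin_le_nhds
  have h := le_of_tendsto hcont (by
    filter_upwards [Ioo_mem_nhdsGT (zero_lt_one' ℝ)] with η hη
    exact key η hη.1 hη.2)
  have e : ENNReal.ofReal ((1 - 0) ^ 2 * (27 / 4)) = 27 / 4 := by
    rw [sub_zero, one_pow, one_mul, ENNReal.ofReal_div_of_pos (by norm_num)]
    norm_num
  rwa [e] at h

lemma volume_polarBodyAt_eq_sub {n : ℕ} (K : Set (EuclideanSpace ℝ (Fin n)))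
    (z : EuclideanSpace ℝ (Fin n)) :
    volume (polarBodyAt K z) = volume (polarBody ((fun x => x + -z) '' K)) := by
  rw [volume_polarBodyAt, polarBody]
  simp only [Set.forall_mem_image, sub_eq_add_neg]

theorem le_volume_mul_volume_polarBodyAt {K : Set Plane} (hc : Convex ℝ K) (hK : IsCompact K)
    {z : Plane} (hz : z ∈ interior K) : 27 / 4 ≤ volume K * volume (polarBodyAt K z) := by
  rw [volume_polarBodyAt_eq_sub]
  have hvol : volume ((fun x => x + -z) '' K) = volume K := by
    rw [Set.image_add_right, measure_preimage_add_right]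
  rw [← hvol]
  refine le_volume_mul_volume_polarBody ?_ (hK.image (by fun_prop)) ?_
  · have := hc.translate (-z)
    simpa [add_comm] using this
  · rw [Set.image_add_right, neg_neg]
    refine (continuous_add_const z).continuousAt.preimage_mem_nhds ?_
    rw [zero_add]
    exact mem_interior_iff_mem_nhds.1 hz

theorem le_volumeProduct {K : Set Plane} (hc : Convex ℝ K) (hK : IsCompact K)
    (hne : (interior K).Nonempty) : 27 / 4 ≤ volumeProduct K := by
  obtain ⟨s, hs⟩ := exists_isSantaloPoint hc hK hne
  rw [volumeProduct_eq hs]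
  exact le_volume_mul_volume_polarBodyAt hc hK hs.1

theorem volumeProduct_le_of_mem_interior {K : Set Plane} (hc : Convex ℝ K) (hK : IsCompact K)
    {z : Plane} (hz : z ∈ interior K) : volumeProduct K ≤ volume K * volume (polarBodyAt K z) := by
  obtain ⟨s, hs⟩ := exists_isSantaloPoint hc hK ⟨z, hz⟩
  rw [volumeProduct_eq hs]
  exact mul_le_mul' le_rfl (hs.2 z hz)

/-! ### The volume product of a triangle -/

open scoped Pointwise in
lemma volume_convexHull_triangle (v : Fin 3 → Plane) :
    volume (convexHull ℝ (Set.range v)) =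
      ENNReal.ofReal (|det2 (v 1 - v 0) (v 2 - v 0)| / 2) := by
  have hr : Set.range v = v 0 +ᵥ ({0, v 1 - v 0, v 2 - v 0} : Set Plane) := by
    ext x
    simp only [Set.mem_range, Fin.exists_fin_succ, Set.mem_vadd_set]
    simp [eq_comm]
  rw [hr, convexHull_vadd, measure_vadd, convexHull_eq_basisMap_image, volume_basisMap_image]

lemma centroid_triangle_mem_interior {v : Fin 3 → Plane} (hv : AffineIndependent ℝ v) :
    (3⁻¹ : ℝ) • (v 0 + v 1 + v 2) ∈ interior (convexHull ℝ (Set.range v)) := by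
  have ht : affineSpan ℝ (Set.range v) = ⊤ := by
    rw [hv.affineSpan_eq_top_iff_card_eq_finrank_add_one]; simp
  have h := AffineBasis.centroid_mem_interior_convexHull (⟨v, hv, ht⟩ : AffineBasis (Fin 3) ℝ Plane)
  have hc : Finset.univ.centroid ℝ v = (3⁻¹ : ℝ) • (v 0 + v 1 + v 2) := by
    rw [Finset.centroid_def, Finset.affineCombination_eq_linear_combination _ _ _ (by simp)]
    simp [Fin.sum_univ_three, Finset.centroidWeights]
  rw [← hc]
  exact h

/-- The volume product of a triangle is at most `27 / 4`, as one sees at the centroid. -/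
theorem volumeProduct_triangle_le {v : Fin 3 → Plane} (hv : AffineIndependent ℝ v) :
    volumeProduct (convexHull ℝ (Set.range v)) ≤ 27 / 4 := by
  have hz := centroid_triangle_mem_interior hv
  set z : Plane := (3⁻¹ : ℝ) • (v 0 + v 1 + v 2) with hzdef
  refine (volumeProduct_le_of_mem_interior (convex_convexHull ℝ _)
    ((Set.finite_range v).isCompact_convexHull (𝕜 := ℝ)) hz).trans ?_
  have hdet : det2 (v 0 - z) (v 1 - z) = det2 (v 1 - v 0) (v 2 - v 0) / 3 := by
    simp [hzdef, det2]; ring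
  -- The interior is nonempty, so the area is positive.
  have hne : det2 (v 1 - v 0) (v 2 - v 0) ≠ 0 := by
    intro h
    have hpos := (isOpen_interior.measure_pos volume ⟨z, hz⟩).trans_le
      (measure_mono interior_subset)
    rw [volume_convexHull_triangle, h] at hpos
    simp at hpos
  have hsub : {y | ∀ x ∈ convexHull ℝ (Set.range v), inner ℝ (x - z) y ≤ 1} ⊆
      {y : Plane | inner ℝ (v 0 - z) y ≤ 1 ∧ inner ℝ (v 1 - z) y ≤ 1 ∧
        inner ℝ (-((v 0 - z) + (v 1 - z))) y ≤ 1} := by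
    intro y hy
    have hv' : ∀ i, inner ℝ (v i - z) y ≤ 1 := fun i =>
      hy _ (subset_convexHull ℝ _ (Set.mem_range_self i))
    refine ⟨hv' 0, hv' 1, ?_⟩
    -- The three vectors from the centroid to the vertices sum to zero.
    convert hv' 2 using 2
    rw [hzdef]
    module
  rw [volume_polarBodyAt, volume_convexHull_triangle]
  refine (mul_le_mul_right (measure_mono hsub) _).trans ?_
  rw [volume_polar_triangle (by rw [hdet]; exact div_ne_zero hne (by norm_num)), hdet,
    ← ENNReal.ofReal_mul (by positivity)]
  have hpos : 0 < |det2 (v 1 - v 0) (v 2 - v 0)| := abs_pos.2 hne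
  have e : |det2 (v 1 - v 0) (v 2 - v 0)| / 2 * (9 / (2 * |det2 (v 1 - v 0) (v 2 - v 0) / 3|)) =
      27 / 4 := by
    rw [abs_div, abs_of_pos (show (0 : ℝ) < 3 by norm_num)]
    field_simp
    norm_num
  rw [e, ENNReal.ofReal_div_of_pos (by norm_num)]
  norm_num

theorem mainTheorem8 (K : ConvexBody (EuclideanSpace ℝ (Fin 2)))
    (hK : (interior (K : Set (EuclideanSpace ℝ (Fin 2)))).Nonempty)
    (v : Fin 3 → EuclideanSpace ℝ (Fin 2)) (hv : AffineIndependent ℝ v) :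
    volumeProduct (convexHull ℝ (Set.range v)) ≤ volumeProduct (K : Set (EuclideanSpace ℝ (Fin 2))) ∧
      volumeProduct (convexHull ℝ (Set.range v)) = 27 / 4 := by
  have h1 := volumeProduct_triangle_le hv
  exact ⟨h1.trans (le_volumeProduct K.convex K.isCompact hK),
    h1.antisymm (le_volumeProduct (convex_convexHull ℝ _)
      ((Set.finite_range v).isCompact_convexHull (𝕜 := ℝ)) ⟨_, centroid_triangle_mem_interior hv⟩)⟩
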